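/- Let $0\le p\le 1$ be fixed. For integers $n,m\ge 1$ let $\mathcal B_{n,m,p}$ be the random multi-hypergraph on $[n]=\{1,\dots,n\}$ consisting of $m$ independently sampled (not necessarily distinct) subsets of $[n]$, each of which contains every vertex $v\in[n]$ independently with probability $p$. Let $\min(\mathcal B_{n,m,p})$ be the set of its inclusion-wise minimal edges, where multiple copies of a minimal edge are counted once. If $p=0$ or $p=1$, then for every $n\ge 1$ we have $|\min(\mathcal B_{n,m,p})|=1$ almost surely for all $m\ge 1$, so $\max_{m\ge 1}\mathbb E[|\min(\mathcal B_{n,m,p})|]=1$. If $0<p<1$, then for every $n\ge1$ the maximum over $m\ge 1$ of $\mathbb E[|\min(\mathcal B_{n,m,p})|]$ exists, and $$\max_{m\ge 1}\ \mathbb E\big[\,|\min(\mathcal B_{n,m,p})|\,\big]=\Theta\!\left(\frac{(1+p)^n}{\sqrt n}\right)\qquad(n\to\infty),$$ with constants depending only on $p$. In order of magnitude the maximum is attained at $m=1/(1-p)^{n/(1+p)}$: for all integers $m(n)\ge1$ with $|m(n)-1/(1-p)^{n/(1+p)}|<1$ (that is, the real number rounded down or up), $\mathbb E[|\min(\mathcal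 B_{n,m(n),p})|]=\Theta\big(\max_{m\ge 1}\mathbb E[|\min(\mathcal B_{n,m,p})|]\big)$. Moreover, writing $m=1/(1-p)^{\alpha n}$, i.e. $\alpha=-(\log_{1-p}m)/n$, if for each $n\ge 1$ the integer $m(n)\ge1$ is an exact maximizer of $m\mapsto \mathbb E[|\min(\mathcal B_{n,m,p})|]$, then the corresponding exponents satisfy $\alpha(n)\to 1/(1+p)$ as $n\to\infty$. -/

import Mathlib

open MeasureTheory ProbabilityTheory Filter Topology Asymptotics

noncomputable section

/-- The law of the random multi-hypergraph `B_{n,m,p}`: `m` independent random subsets of an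
`n`-element vertex set, each containing every vertex independently with probability `p`.
An outcome `B : Fin m → Set (Fin n)` lists the `m` (not necessarily distinct) edges. -/
def hypergraphLaw (n m : ℕ) (p : unitInterval) : Measure (Fin m → Set (Fin n)) :=
  Measure.pi fun _ : Fin m => setBernoulli (Set.univ : Set (Fin n)) p

/-- The minimization of a multi-hypergraph: the set of its inclusion-wise minimal edges.
Being a set of edges, it contains only one copy of each minimal edge. -/
def minimization {n m : ℕ} (B : Fin m → Set (Fin n)) : Set (Set (Fin n)) :=
  {E | Minimal (fun F => F ∈ Set.range B) E}

/-- The expected number of minimal edges of `B_{n,m,p}`. -/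
def expectedMin (n m : ℕ) (p : unitInterval) : ℝ :=
  ∫ B, ((minimization B).ncard : ℝ) ∂(hypergraphLaw n m p)

/-- The set of values of the expected number of minimal edges of `B_{n,m,p}`, over `m ≥ 1`. -/
def expectedMinValues (n : ℕ) (p : unitInterval) : Set ℝ :=
  {x | ∃ m : ℕ, 1 ≤ m ∧ x = expectedMin n m p}

/-- The supremum over `m ≥ 1` of the expected number of minimal edges of `B_{n,m,p}`. -/
def maxExpectedMin (n : ℕ) (p : unitInterval) : ℝ :=
  sSup (expectedMinValues n p)

/-- The real number `m = 1 / (1 - p) ^ (n / (1 + p))`. -/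
def optimalEdges (n : ℕ) (p : unitInterval) : ℝ :=
  1 / (1 - (p : ℝ)) ^ ((n : ℝ) / (1 + (p : ℝ)))

/-- The exponent `α` with `m = 1 / (1 - p) ^ (α * n)`. -/
def edgeExponent (n m : ℕ) (p : unitInterval) : ℝ :=
  -(Real.logb (1 - (p : ℝ)) m) / n

end

/-!
The expected number of minimal edges can be computed exactly. A set `E` of size `k` is a minimal
edge if and only if no edge is a proper subset of `E` but some edge is a subset of `E`. With
`q = 1 - p`, a random edge lies inside `E` with probability `q ^ (n - k)` and equals `E` with
probability `p ^ k * q ^ (n - k)`, so by independence the expectation is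
`∑ k, (n.choose k) * ((1 - q ^ (n - k) + p ^ k * q ^ (n - k)) ^ m - (1 - q ^ (n - k)) ^ m)`
(`expectedMin_eq_sum`). It equals `1` for `m = 1` and tends to `1` as `m → ∞`, so the maximum over
`m` exists.

For `k ≥ 1` the `k`-th summand is, up to constants depending on `p`, at most the binomial weight
`(n.choose k) * p ^ k` times `min t t⁻¹`, where `t = m * q ^ (n - k)` is the expected number of
edges inside a given `k`-set (`minimal_probability_le`). As `k` varies, `t` runs through a geometric
progression, so the factors `min t t⁻¹` have bounded sum and the expectation is at most a constant
times the largest weight. The weights sum to `(1 + p) ^ n` and are spread over about `√n` indices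
around `n * p / (1 + p)`, whence the largest one has order `(1 + p) ^ n / √n`
(`exists_binomialWeight_le`, `le_binomialWeight_mode`). Conversely, if `m` is within a constant
factor of `q ^ (-n / (1 + p))`, then `t` is of order `1` at the mode `k` of the weights, and this
single summand already has order `(1 + p) ^ n / √n` (`exists_le_expectedMin`).

If the exponent `α` of `m` stays `ε` away from `1 / (1 + p)`, every `k` is either at distance of
order `ε * n` from `n * p / (1 + p)`, where by Chebyshev's inequality the weights sum to only
`O((1 + p) ^ n / n)`, or `t` is exponentially far from `1`. The expectation is then
`o((1 + p) ^ n / √n)`, so such an `m` is not a maximizer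
(`exists_expectedMin_le_of_exponent_far`).
-/

/-! ### The exact formula for the expectation -/

instance isProbabilityMeasure_hypergraphLaw (n m : ℕ) (p : unitInterval) :
    IsProbabilityMeasure (hypergraphLaw n m p) := by
  unfold hypergraphLaw; infer_instance

lemma measureReal_setBernoulli_univ_singleton {n : ℕ} (p : unitInterval) (E : Finset (Fin n)) :
    (setBernoulli (Set.univ : Set (Fin n)) p).real {(E : Set (Fin n))} =
      (p : ℝ) ^ E.card * (1 - p : ℝ) ^ (n - E.card) := by
  rw [setBernoulli_real_singleton p (Set.subset_univ _) Set.finite_univ,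
    Set.ncard_sdiff' (Set.subset_univ _) Set.finite_univ]
  simp

lemma measureReal_setBernoulli_univ_subsets {n : ℕ} (p : unitInterval) (E : Finset (Fin n)) :
    (setBernoulli (Set.univ : Set (Fin n)) p).real {F | F ⊆ (E : Set (Fin n))} =
      (1 - p : ℝ) ^ (n - E.card) := by
  have hset : {F : Set (Fin n) | F ⊆ (E : Set (Fin n))} =
      ⋃ F ∈ E.powerset, {(F : Set (Fin n))} := by
    ext F
    simp only [Set.mem_ofPred_eq, Set.mem_iUnion, Finset.mem_powerset, Set.mem_singleton_iff,
      exists_prop]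
    constructor
    · intro h
      lift F to Finset (Fin n) using Set.toFinite F
      exact ⟨F, by simpa using h, rfl⟩
    · rintro ⟨F, h, rfl⟩
      simpa using h
  rw [hset, measureReal_biUnion_finset (by intro a _ b _ hab; simpa [eq_comm] using hab)
    (fun _ _ => measurableSet_singleton _)]
  simp_rw [measureReal_setBernoulli_univ_singleton]
  have hcard : E.card ≤ n := by simpa using E.card_le_univ
  calc ∑ F ∈ E.powerset, (p : ℝ) ^ F.card * (1 - p : ℝ) ^ (n - F.card)
      = ∑ F ∈ E.powerset, (1 - p : ℝ) ^ (n - E.card) *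
          ((p : ℝ) ^ F.card * (1 - p : ℝ) ^ (E.card - F.card)) := by
        refine Finset.sum_congr rfl fun F hF => ?_
        have h := Finset.card_le_card (Finset.mem_powerset.1 hF)
        rw [show n - F.card = (n - E.card) + (E.card - F.card) by omega, pow_add]
        ring
    _ = (1 - p : ℝ) ^ (n - E.card) := by
        rw [← Finset.mul_sum, Finset.sum_pow_mul_eq_add_pow]
        simp

lemma measureReal_setBernoulli_univ_ssubsets {n : ℕ} (p : unitInterval) (E : Finset (Fin n)) :
    (setBernoulli (Set.univ : Set (Fin n)) p).real {F | F ⊂ (E : Set (Fin n))} =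
      (1 - p : ℝ) ^ (n - E.card) - (p : ℝ) ^ E.card * (1 - p : ℝ) ^ (n - E.card) := by
  rw [← measureReal_setBernoulli_univ_singleton, ← measureReal_setBernoulli_univ_subsets,
    ← measureReal_sdiff (by simp) (measurableSet_singleton _)]
  congr 1
  ext F
  simp [ssubset_iff_subset_ne]

/-- If no edge may lie in a family `S`, independence gives the `m`-th power of the probability
of avoiding `S`. -/
lemma hypergraphLaw_real_forall_notMem {n : ℕ} (m : ℕ) (p : unitInterval)
    (S : Set (Set (Fin n))) :
    (hypergraphLaw n m p).real {B | ∀ i, B i ∉ S} =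
      (1 - (setBernoulli (Set.univ : Set (Fin n)) p).real S) ^ m := by
  have hset : {B : Fin m → Set (Fin n) | ∀ i, B i ∉ S} = Set.univ.pi fun _ => Sᶜ := by
    ext; simp
  rw [hset, measureReal_def, hypergraphLaw, Measure.pi_pi, ENNReal.toReal_prod]
  simp only [← measureReal_def, Finset.prod_const, Finset.card_univ, Fintype.card_fin]
  rw [probReal_compl_eq_one_sub (Set.toFinite S).measurableSet]

lemma mem_minimization_iff {n m : ℕ} {B : Fin m → Set (Fin n)} {E : Set (Fin n)} :
    E ∈ minimization B ↔ (∀ i, ¬ B i ⊂ E) ∧ ¬ ∀ i, ¬ B i ⊆ E := by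
  simp only [minimization, Set.mem_ofPred_eq, minimal_iff_forall_lt, Set.mem_range,
    not_exists, not_forall, not_not]
  constructor
  · rintro ⟨⟨i, rfl⟩, h⟩
    exact ⟨fun j hj => h hj j rfl, i, subset_rfl⟩
  · rintro ⟨h, i, hi⟩
    exact ⟨⟨i, by_contra fun hne => h i (hi.ssubset_of_ne hne)⟩,
      fun F hF j hj => h j (hj ▸ hF)⟩

lemma hypergraphLaw_real_mem_minimization {n : ℕ} (m : ℕ) (p : unitInterval)
    (E : Finset (Fin n)) :
    (hypergraphLaw n m p).real {B | (E : Set (Fin n)) ∈ minimization B} =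
      (1 - (1 - p : ℝ) ^ (n - E.card) + (p : ℝ) ^ E.card * (1 - p : ℝ) ^ (n - E.card)) ^ m -
        (1 - (1 - p : ℝ) ^ (n - E.card)) ^ m := by
  have hset : {B : Fin m → Set (Fin n) | (E : Set (Fin n)) ∈ minimization B} =
      {B | ∀ i, B i ∉ {F | F ⊂ (E : Set (Fin n))}} \
        {B | ∀ i, B i ∉ {F | F ⊆ (E : Set (Fin n))}} := by
    ext B
    rw [Set.mem_ofPred_eq, mem_minimization_iff]
    rfl
  have hsub : {B : Fin m → Set (Fin n) | ∀ i, B i ∉ {F | F ⊆ (E : Set (Fin n))}} ⊆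
      {B | ∀ i, B i ∉ {F | F ⊂ (E : Set (Fin n))}} :=
    fun B hB i hi => hB i (le_of_lt (show B i < (E : Set (Fin n)) from hi))
  rw [hset, measureReal_sdiff hsub (Set.toFinite _).measurableSet,
    hypergraphLaw_real_forall_notMem, hypergraphLaw_real_forall_notMem,
    measureReal_setBernoulli_univ_subsets, measureReal_setBernoulli_univ_ssubsets]
  ring

/-- The expected number of minimal edges with `k` vertices is the number of `k`-subsets times the
probability that no edge is a proper subset of a given one, minus the probability that no edge is
a subset of it at all. -/
theorem expectedMin_eq_sum (n m : ℕ) (p : unitInterval) :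
    expectedMin n m p = ∑ k ∈ Finset.range (n + 1), (n.choose k : ℝ) *
      ((1 - (1 - p : ℝ) ^ (n - k) + (p : ℝ) ^ k * (1 - p : ℝ) ^ (n - k)) ^ m -
        (1 - (1 - p : ℝ) ^ (n - k)) ^ m) := by
  classical
  have hcard (B : Fin m → Set (Fin n)) : ((minimization B).ncard : ℝ) =
      ∑ E : Finset (Fin n),
        Set.indicator {B | (E : Set (Fin n)) ∈ minimization B} (1 : (Fin m → Set (Fin n)) → ℝ) B := by
    have hset : minimization B =
        (fun E : Finset (Fin n) => (E : Set (Fin n))) ''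
          ↑(Finset.univ.filter fun E : Finset (Fin n) => (E : Set (Fin n)) ∈ minimization B) := by
      ext F
      lift F to Finset (Fin n) using Set.toFinite F
      simp
    rw [hset, Set.ncard_image_of_injective _ Finset.coe_injective, Set.ncard_coe_finset,
      Finset.card_filter]
    simp [Set.indicator]
  unfold expectedMin
  simp_rw [hcard]
  rw [integral_finsetSum _ fun E _ => Integrable.of_finite]
  simp_rw [integral_indicator_one (Set.toFinite _).measurableSet,
    hypergraphLaw_real_mem_minimization]
  have h := Finset.sum_powerset_apply_card (x := (Finset.univ : Finset (Fin n))) fun k =>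
    ((1 - (1 - p : ℝ) ^ (n - k) + (p : ℝ) ^ k * (1 - p : ℝ) ^ (n - k)) ^ m -
        (1 - (1 - p : ℝ) ^ (n - k)) ^ m)
  rw [Finset.powerset_univ] at h
  rw [h]
  simp

/-! ### Degenerate probabilities -/

lemma ncard_minimization_const {n m : ℕ} (hm : 1 ≤ m) (E : Set (Fin n)) :
    (minimization (fun _ : Fin m => E)).ncard = 1 := by
  have : Nonempty (Fin m) := ⟨⟨0, hm⟩⟩
  have hset : minimization (fun _ : Fin m => E) = {E} := by
    ext F
    simp only [minimization, Set.range_const, Set.mem_ofPred_eq, Set.mem_singleton_iff]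
    exact ⟨fun h => h.prop, fun h => ⟨h, fun G hG _ => (h.trans hG.symm).le⟩⟩
  rw [hset, Set.ncard_singleton]

lemma ae_ncard_minimization_eq_one {n m : ℕ} (hm : 1 ≤ m) {p : unitInterval} {E : Set (Fin n)}
    (hE : setBernoulli (Set.univ : Set (Fin n)) p = Measure.dirac E) :
    ∀ᵐ B ∂(hypergraphLaw n m p), (minimization B).ncard = 1 := by
  have h (i : Fin m) : ∀ᵐ B ∂(hypergraphLaw n m p), B i = E := by
    have h1 : ∀ᵐ F ∂(setBernoulli (Set.univ : Set (Fin n)) p), F = E := by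
      rw [hE]
      exact (ae_dirac_iff (measurableSet_singleton E)).2 rfl
    exact (Measure.tendsto_eval_ae_ae
      (μ := fun _ : Fin m => setBernoulli (Set.univ : Set (Fin n)) p) (i := i)).eventually h1
  filter_upwards [ae_all_iff.2 h] with B hB
  rw [funext hB]
  exact ncard_minimization_const hm E

lemma expectedMin_eq_one_of_ae {n m : ℕ} {p : unitInterval}
    (h : ∀ᵐ B ∂(hypergraphLaw n m p), (minimization B).ncard = 1) : expectedMin n m p = 1 := by
  have h' : (fun B => ((minimization B).ncard : ℝ)) =ᵐ[hypergraphLaw n m p] fun _ => (1 : ℝ) := by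
    filter_upwards [h] with B hB
    simp [hB]
  rw [expectedMin, integral_congr_ae h']
  simp

lemma degenerate_expectedMin {p : unitInterval} (hp : p = 0 ∨ p = 1) (n : ℕ) :
    (∀ m : ℕ, 1 ≤ m → ∀ᵐ B ∂(hypergraphLaw n m p), (minimization B).ncard = 1) ∧
      IsGreatest (expectedMinValues n p) 1 := by
  have hae (m : ℕ) (hm : 1 ≤ m) : ∀ᵐ B ∂(hypergraphLaw n m p), (minimization B).ncard = 1 := by
    rcases hp with rfl | rfl
    · exact ae_ncard_minimization_eq_one hm (setBernoulli_zero _)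
    · exact ae_ncard_minimization_eq_one hm (setBernoulli_one _)
  refine ⟨hae, ⟨1, le_rfl, (expectedMin_eq_one_of_ae (hae 1 le_rfl)).symm⟩, ?_⟩
  rintro x ⟨m, hm, rfl⟩
  exact (expectedMin_eq_one_of_ae (hae m hm)).le

/-! ### Existence of the maximum -/

lemma expectedMin_one (n : ℕ) (p : unitInterval) : expectedMin n 1 p = 1 := by
  rw [expectedMin_eq_sum]
  have h := add_pow (p : ℝ) (1 - p) n
  rw [add_sub_cancel, one_pow] at h
  refine Eq.trans (Finset.sum_congr rfl fun k _ => ?_) h.symm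
  ring

lemma tendsto_expectedMin (n : ℕ) {p : unitInterval} (hp : 0 < p ∧ p < 1) :
    Tendsto (fun m => expectedMin n m p) atTop (𝓝 1) := by
  have hp0 : (0 : ℝ) < p := hp.1
  have hp1 : (p : ℝ) < 1 := hp.2
  have hq0 : 0 < 1 - (p : ℝ) := by linarith
  have hq1 : 1 - (p : ℝ) < 1 := by linarith
  simp_rw [expectedMin_eq_sum]
  rw [show (1 : ℝ) = ∑ k ∈ Finset.range (n + 1), (n.choose k : ℝ) * (if k = 0 then 1 else 0) by
    simp]
  refine tendsto_finsetSum _ fun k hk => Tendsto.const_mul _ ?_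
  have hkn : k ≤ n := by simpa [Nat.lt_succ_iff] using hk
  have hlow : Tendsto (fun m => (1 - (1 - p : ℝ) ^ (n - k)) ^ m) atTop (𝓝 0) := by
    apply tendsto_pow_atTop_nhds_zero_of_lt_one
    · linarith [pow_le_one₀ (n := n - k) hq0.le hq1.le]
    · linarith [pow_pos hq0 (n - k)]
  rcases Nat.eq_zero_or_pos k with rfl | hk0
  · simpa using hlow.const_sub 1
  · have hpk : (p : ℝ) ^ k < 1 := pow_lt_one₀ hp0.le hp1 hk0.ne'
    have hqk := pow_pos hq0 (n - k)
    have hupp : Tendsto (fun m => (1 - (1 - p : ℝ) ^ (n - k) +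
        (p : ℝ) ^ k * (1 - p : ℝ) ^ (n - k)) ^ m) atTop (𝓝 0) := by
      apply tendsto_pow_atTop_nhds_zero_of_lt_one
      · have := pow_le_one₀ (n := n - k) hq0.le hq1.le
        have : 0 ≤ (p : ℝ) ^ k * (1 - p : ℝ) ^ (n - k) := by positivity
        linarith
      · nlinarith
    simpa [hk0.ne'] using hupp.sub hlow

/-- Since the expectation equals `1` at `m = 1` and tends to `1` as `m → ∞`, it attains its
supremum. -/
theorem isGreatest_maxExpectedMin (n : ℕ) {p : unitInterval} (hp : 0 < p ∧ p < 1) :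
    IsGreatest (expectedMinValues n p) (maxExpectedMin n p) := by
  suffices h : ∃ a, IsGreatest (expectedMinValues n p) a by
    obtain ⟨a, ha⟩ := h
    rw [maxExpectedMin, ha.csSup_eq]
    exact ha
  by_cases hall : ∀ m, 1 ≤ m → expectedMin n m p ≤ 1
  · refine ⟨1, ⟨1, le_rfl, (expectedMin_one n p).symm⟩, ?_⟩
    rintro x ⟨m, hm, rfl⟩
    exact hall m hm
  · push Not at hall
    obtain ⟨m₀, hm₀, hlt⟩ := hall
    obtain ⟨N, hN⟩ := eventually_atTop.1 ((tendsto_expectedMin n hp).eventually_lt_const hlt)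
    have hne : (Finset.Icc 1 (max m₀ N)).Nonempty := ⟨m₀, by simp [hm₀]⟩
    obtain ⟨m₁, hm₁, hmax⟩ := Finset.exists_max_image _ (fun m => expectedMin n m p) hne
    refine ⟨expectedMin n m₁ p, ⟨m₁, (Finset.mem_Icc.1 hm₁).1, rfl⟩, ?_⟩
    rintro x ⟨m, hm, rfl⟩
    rcases le_total m (max m₀ N) with h | h
    · exact hmax m (Finset.mem_Icc.2 ⟨hm, h⟩)
    · exact (hN m ((le_max_right _ _).trans h)).le.trans (hmax m₀ (by simp [hm₀]))

lemma expectedMin_le_maxExpectedMin {n m : ℕ} (hm : 1 ≤ m) {p : unitInterval}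
    (hp : 0 < p ∧ p < 1) : expectedMin n m p ≤ maxExpectedMin n p :=
  (isGreatest_maxExpectedMin n hp).2 ⟨m, hm, rfl⟩

/-! ### Local bounds for binomial weights -/

/-- The weight `(n choose k) p ^ k`. These sum to `(1 + p) ^ n`, and dividing by this total gives
the binomial distribution with `n` trials and success probability `p / (1 + p)`. -/
noncomputable def binomialWeight (p : ℝ) (n k : ℕ) : ℝ := n.choose k * p ^ k

/-- The mode `⌊(n + 1) p / (1 + p)⌋` of the weights `binomialWeight p n`. -/
noncomputable def binomialMode (p : ℝ) (n : ℕ) : ℕ := ⌊((n : ℝ) + 1) * p / (1 + p)⌋₊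

section binomialWeight

variable {p : ℝ} {n k : ℕ}

lemma binomialWeight_nonneg (hp : 0 < p) (n k : ℕ) : 0 ≤ binomialWeight p n k := by
  unfold binomialWeight; positivity

lemma sum_binomialWeight (p : ℝ) (n : ℕ) :
    ∑ k ∈ Finset.range (n + 1), binomialWeight p n k = (1 + p) ^ n := by
  rw [add_comm 1 p, add_pow]
  refine Finset.sum_congr rfl fun k _ => ?_
  rw [binomialWeight]
  ring

lemma binomialWeight_succ (p : ℝ) (n k : ℕ) :
    ((k : ℝ) + 1) * binomialWeight p n (k + 1) = ((n : ℝ) - k) * p * binomialWeight p n k := by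
  have h : (n.choose (k + 1) : ℝ) * (k + 1) = n.choose k * ((n : ℝ) - k) := by
    rcases le_total k n with hk | hk
    · have := Nat.choose_succ_right_eq n k
      rw [← Nat.cast_sub hk]
      exact_mod_cast this
    · rcases hk.eq_or_lt with rfl | hk
      · simp
      · simp [Nat.choose_eq_zero_of_lt hk, Nat.choose_eq_zero_of_lt (hk.trans (Nat.lt_succ_self k))]
  unfold binomialWeight
  rw [pow_succ]
  linear_combination p ^ k * p * h

lemma sum_binomialWeight_mul_sq (hp : 0 < p) (n : ℕ) :
    ∑ k ∈ Finset.range (n + 1), binomialWeight p n k * (k * (1 + p) - n * p) ^ 2 =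
      n * p * (1 + p) ^ n := by
  have h := congrArg (Polynomial.eval (p / (1 + p))) (bernsteinPolynomial.variance ℝ n)
  simp only [Polynomial.eval_finsetSum, bernsteinPolynomial, Polynomial.eval_mul,
    Polynomial.eval_pow, Polynomial.eval_sub, Polynomial.eval_X,
    Polynomial.eval_natCast, Polynomial.eval_one, nsmul_eq_mul] at h
  have hp1 : 1 + p ≠ 0 := by positivity
  have hq : 1 - p / (1 + p) = (1 + p)⁻¹ := by field_simp; ring
  rw [hq] at h
  have h2 : ∑ k ∈ Finset.range (n + 1), binomialWeight p n k * (k * (1 + p) - n * p) ^ 2 =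
      (1 + p) ^ 2 * (1 + p) ^ n * ∑ k ∈ Finset.range (n + 1), (n * (p / (1 + p)) - k) ^ 2 *
        (n.choose k * (p / (1 + p)) ^ k * (1 + p)⁻¹ ^ (n - k)) := by
    rw [Finset.mul_sum]
    refine Finset.sum_congr rfl fun k hk => ?_
    have hkn : k ≤ n := by simpa [Nat.lt_succ_iff] using hk
    obtain ⟨l, rfl⟩ := Nat.exists_eq_add_of_le hkn
    rw [binomialWeight, Nat.add_sub_cancel_left, pow_add, div_pow, inv_pow]
    field_simp
    ring
  rw [h2, h]
  field_simp

/-- Chebyshev's inequality. -/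
lemma sum_filter_binomialWeight_le (hp : 0 < p) (n : ℕ) {d : ℝ} (hd : 0 < d) :
    ∑ k ∈ (Finset.range (n + 1)).filter (fun k : ℕ => d ≤ |(k : ℝ) * (1 + p) - n * p|),
      binomialWeight p n k ≤
      n * p * (1 + p) ^ n / d ^ 2 := by
  rw [le_div_iff₀ (by positivity), ← sum_binomialWeight_mul_sq hp, Finset.sum_mul]
  refine (Finset.sum_le_sum fun k hk => ?_).trans
    (Finset.sum_le_sum_of_subset_of_nonneg (Finset.filter_subset _ _) fun k _ _ =>
      mul_nonneg (binomialWeight_nonneg hp n k) (sq_nonneg _))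
  refine mul_le_mul_of_nonneg_left ?_ (binomialWeight_nonneg hp n k)
  rw [← sq_abs ((k : ℝ) * (1 + p) - n * p)]
  exact pow_le_pow_left₀ hd.le (Finset.mem_filter.1 hk).2 2

lemma binomialMode_le (hp : 0 < p) (n : ℕ) :
    (binomialMode p n : ℝ) ≤ ((n : ℝ) + 1) * p / (1 + p) :=
  Nat.floor_le (by positivity)

lemma lt_binomialMode_add_one (p : ℝ) (n : ℕ) :
    ((n : ℝ) + 1) * p / (1 + p) < binomialMode p n + 1 :=
  Nat.lt_floor_add_one _

lemma binomialWeight_le_succ (hp : 0 < p) (hk : k < binomialMode p n) :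
    binomialWeight p n k ≤ binomialWeight p n (k + 1) := by
  have hk' : (k : ℝ) + 1 ≤ ((n : ℝ) + 1) * p / (1 + p) :=
    le_trans (by exact_mod_cast hk) (binomialMode_le hp n)
  rw [le_div_iff₀ (by positivity)] at hk'
  have h := binomialWeight_succ p n k
  have h0 := binomialWeight_nonneg hp n k
  refine le_of_mul_le_mul_left ?_ (show (0 : ℝ) < k + 1 by positivity)
  rw [h]
  gcongr
  linarith

lemma binomialWeight_succ_le (hp : 0 < p) (hk : binomialMode p n ≤ k) :
    binomialWeight p n (k + 1) ≤ binomialWeight p n k := by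
  have hk' : ((n : ℝ) + 1) * p / (1 + p) ≤ k + 1 := by
    refine (lt_binomialMode_add_one p n).le.trans ?_
    gcongr
  rw [div_le_iff₀ (by positivity)] at hk'
  have h := binomialWeight_succ p n k
  have h0 := binomialWeight_nonneg hp n k
  refine le_of_mul_le_mul_left ?_ (show (0 : ℝ) < k + 1 by positivity)
  rw [h]
  gcongr
  linarith

lemma binomialWeight_le_mode (hp : 0 < p) (n k : ℕ) :
    binomialWeight p n k ≤ binomialWeight p n (binomialMode p n) := by
  rcases le_total k (binomialMode p n) with hk | hk
  · induction hk using Nat.decreasingInduction with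
    | self => exact le_rfl
    | of_succ k hk ih => exact (binomialWeight_le_succ hp hk).trans ih
  · induction k, hk using Nat.le_induction with
    | base => exact le_rfl
    | succ k hk ih => exact (binomialWeight_succ_le hp hk).trans ih

/-- Near the mode the weights decay slowly: each of the first `s` steps upwards from it loses at most
a factor `1 - O(s / n)`. -/
lemma le_binomialWeight_mode_add (hp : 0 < p) (n : ℕ) {s i : ℕ} (hi : i ≤ s)
    (hs : s * (1 + p) ≤ ((n : ℝ) + 1) * p / (1 + p)) :
    binomialWeight p n (binomialMode p n) *
        (1 - s * (1 + p) / (((n : ℝ) + 1) * p / (1 + p))) ^ i ≤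
      binomialWeight p n (binomialMode p n + i) := by
  have hmode := binomialMode_le hp n
  set M := ((n : ℝ) + 1) * p / (1 + p) with hM
  have hM0 : 0 < M := by positivity
  have hMn : (n : ℝ) + 1 = M + M / p := by
    rw [hM]; field_simp; ring
  induction i with
  | zero => simp
  | succ i ih =>
    have ih := ih (by omega)
    have hrec := binomialWeight_succ p n (binomialMode p n + i)
    have hw := binomialWeight_nonneg hp n (binomialMode p n + i)
    set w := binomialWeight p n (binomialMode p n + i)
    have hr0 : 0 ≤ 1 - s * (1 + p) / M := by
      rw [sub_nonneg, div_le_one hM0]; exact hs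
    have his : (i : ℝ) + 1 ≤ s := by exact_mod_cast hi
    rw [pow_succ, ← mul_assoc]
    refine (mul_le_mul_of_nonneg_right ih hr0).trans ?_
    rw [← add_assoc]
    push_cast at hrec
    have hpos : (0 : ℝ) < binomialMode p n + i + 1 := by positivity
    refine le_of_mul_le_mul_left ?_ hpos
    rw [hrec, show (binomialMode p n + i + 1 : ℝ) * (w * (1 - s * (1 + p) / M)) =
      ((binomialMode p n + i + 1 : ℝ) * (1 - s * (1 + p) / M)) * w by ring]
    refine mul_le_mul_of_nonneg_right ?_ hw
    -- the ratio of consecutive weights is at least `(M - s p) / (M + s)`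
    have h1 : (binomialMode p n + i + 1 : ℝ) ≤ M + s := by linarith
    have h2 : M - s * p ≤ (n - (binomialMode p n + i)) * p := by
      have : M / p - s ≤ n - (binomialMode p n + i) := by linarith
      calc M - s * p = (M / p - s) * p := by field_simp
        _ ≤ _ := by gcongr
    have h3 : (M + s) * (1 - s * (1 + p) / M) ≤ M - s * p := by
      have : (M + s) * (1 - s * (1 + p) / M) = M - s * p - s * s * (1 + p) / M := by
        field_simp; ring
      rw [this]
      have : 0 ≤ (s : ℝ) * s * (1 + p) / M := by positivity
      linarith
    exact (mul_le_mul_of_nonneg_right h1 hr0).trans (h3.trans h2)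

/-- The `√n` weights next to the mode are all comparable to the largest one, so it is at most
`O(1 / √n)` times their total. -/
theorem exists_binomialWeight_le (hp : 0 < p) :
    ∃ C > 0, ∀ n k : ℕ, 1 ≤ n → binomialWeight p n k ≤ C * ((1 + p) ^ n / √n) := by
  refine ⟨2 * √(2 * (1 + p) ^ 2 / p), by positivity, fun n k hn => ?_⟩
  refine (binomialWeight_le_mode hp n k).trans ?_
  set M := ((n : ℝ) + 1) * p / (1 + p) with hM
  set W := binomialWeight p n (binomialMode p n)
  have hW : 0 ≤ W := binomialWeight_nonneg hp _ _
  have hM0 : 0 < M := by positivity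
  -- with this choice, `s` steps away from the mode at most half of the weight is lost
  set s := ⌊√(M / (2 * (1 + p)))⌋₊ with hs
  have hs1 : (s : ℝ) ≤ √(M / (2 * (1 + p))) := Nat.floor_le (by positivity)
  have hs2 : √(M / (2 * (1 + p))) < s + 1 := Nat.lt_floor_add_one _
  have hss : (s : ℝ) * (s * (1 + p) / M) ≤ 1 / 2 := by
    have h := pow_le_pow_left₀ (by positivity) hs1 2
    rw [Real.sq_sqrt (by positivity), le_div_iff₀ (by positivity)] at h
    rw [← mul_div_assoc, div_le_iff₀ hM0]
    linarith
  have hsM : s * (1 + p) ≤ M := by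
    rw [← div_le_one hM0]
    rcases Nat.eq_zero_or_pos s with h0 | h0
    · simp [h0]
    · have : (1 : ℝ) ≤ s := by exact_mod_cast h0
      have h1 : 0 ≤ s * (1 + p) / M := by positivity
      nlinarith
  have hhalf (i : ℕ) (hi : i ≤ s) : W / 2 ≤ binomialWeight p n (binomialMode p n + i) := by
    refine le_trans ?_ (le_binomialWeight_mode_add hp n hi hsM)
    rw [div_eq_mul_inv]
    refine mul_le_mul_of_nonneg_left ?_ hW
    have h1 : 0 ≤ s * (1 + p) / M := by positivity
    have h2 : s * (1 + p) / M ≤ 1 := (div_le_one hM0).2 hsM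
    have hb := one_add_mul_le_pow (a := -(s * (1 + p) / M)) (by linarith) i
    rw [← sub_eq_add_neg] at hb
    have hi' : (i : ℝ) ≤ s := by exact_mod_cast hi
    have := mul_le_mul_of_nonneg_right hi' h1
    refine le_trans ?_ hb
    linarith
  have hsum : (s + 1) * (W / 2) ≤ (1 + p) ^ n := by
    have h1 : (s + 1) * (W / 2) ≤
        ∑ i ∈ Finset.range (s + 1), binomialWeight p n (binomialMode p n + i) := by
      have := Finset.card_nsmul_le_sum (Finset.range (s + 1))
        (fun i => binomialWeight p n (binomialMode p n + i)) (W / 2)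
        fun i hi => hhalf i (Nat.lt_succ_iff.1 (Finset.mem_range.1 hi))
      simpa using this
    have h2 : ∑ i ∈ Finset.range (s + 1), binomialWeight p n (binomialMode p n + i) ≤
        ∑ k ∈ Finset.range (binomialMode p n + (s + 1) + (n + 1)), binomialWeight p n k := by
      rw [Finset.sum_range_add _ _ (n + 1), Finset.sum_range_add _ _ (s + 1)]
      have h3 := Finset.sum_nonneg fun k (_ : k ∈ Finset.range (binomialMode p n)) =>
        binomialWeight_nonneg hp n k
      have h4 := Finset.sum_nonneg fun k (_ : k ∈ Finset.range (n + 1)) =>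
        binomialWeight_nonneg hp n (binomialMode p n + (s + 1) + k)
      linarith
    refine h1.trans (h2.trans ?_)
    rw [← sum_binomialWeight, add_comm _ (n + 1), Finset.sum_range_add, add_le_iff_nonpos_right]
    refine (Finset.sum_eq_zero fun k _ => ?_).le
    simp [binomialWeight, Nat.choose_eq_zero_of_lt (show n < n + 1 + k by omega)]
  have hn0 : (0 : ℝ) < n := by exact_mod_cast hn
  have hkey : √(M / (2 * (1 + p))) * W ≤ 2 * (1 + p) ^ n := by
    have := mul_le_mul_of_nonneg_right hs2.le hW
    linarith
  have hle : √n ≤ √(2 * (1 + p) ^ 2 / p) * √(M / (2 * (1 + p))) := by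
    rw [← Real.sqrt_mul (by positivity)]
    refine Real.sqrt_le_sqrt ?_
    rw [hM]
    have : 2 * (1 + p) ^ 2 / p * ((n + 1) * p / (1 + p) / (2 * (1 + p))) = (n : ℝ) + 1 := by
      field_simp
    linarith
  rw [← mul_div_assoc, le_div_iff₀ (by positivity)]
  calc W * √n ≤ W * (√(2 * (1 + p) ^ 2 / p) * √(M / (2 * (1 + p)))) := by gcongr
    _ = √(2 * (1 + p) ^ 2 / p) * (√(M / (2 * (1 + p))) * W) := by ring
    _ ≤ √(2 * (1 + p) ^ 2 / p) * (2 * (1 + p) ^ n) := by gcongr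
    _ = _ := by ring

/-- By Chebyshev's inequality at least three quarters of the total weight is shared by `O(√n)`
indices, so the largest weight is at least of order `1 / √n` times the total. -/
theorem le_binomialWeight_mode (hp : 0 < p) (hn : 1 ≤ n) :
    1 / 4 * ((1 + p) ^ n / √n) ≤ binomialWeight p n (binomialMode p n) := by
  have hn1 : (1 : ℝ) ≤ n := by exact_mod_cast hn
  have hsn : 1 ≤ √(n : ℝ) := Real.one_le_sqrt.2 hn1
  set W := binomialWeight p n (binomialMode p n)
  have hW : 0 ≤ W := binomialWeight_nonneg hp _ _
  have hcheb := sum_filter_binomialWeight_le hp n (d := 2 * √(n * p)) (by positivity)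
  have hsplit := Finset.sum_filter_add_sum_filter_not (Finset.range (n + 1))
    (fun k : ℕ => 2 * √(n * p) ≤ |(k : ℝ) * (1 + p) - n * p|) (binomialWeight p n)
  rw [sum_binomialWeight] at hsplit
  have hquarter : n * p * (1 + p) ^ n / (2 * √(n * p)) ^ 2 = (1 + p) ^ n / 4 := by
    rw [mul_pow, Real.sq_sqrt (by positivity)]
    field_simp
    norm_num
  rw [hquarter] at hcheb
  set μ := n * p / (1 + p) with hμ
  have hμ0 : 0 ≤ μ := by positivity
  have hsub : (Finset.range (n + 1)).filter
      (fun k : ℕ => ¬ 2 * √(n * p) ≤ |(k : ℝ) * (1 + p) - n * p|) ⊆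
      Finset.Ico ⌈μ - √n⌉₊ ⌈μ + √n⌉₊ := by
    intro k hk
    have hk := (Finset.mem_filter.1 hk).2
    have h2 : 2 * √(n * p) ≤ √n * (1 + p) := by
      rw [Real.sqrt_mul (by positivity)]
      have h3 : 2 * √p ≤ 1 + p := by
        nlinarith [Real.sq_sqrt hp.le, sq_nonneg (√p - 1)]
      nlinarith
    have h4 : |(k : ℝ) - μ| < √n := by
      have h5 : (k : ℝ) * (1 + p) - n * p = (k - μ) * (1 + p) := by
        rw [hμ]; field_simp
      rw [h5, abs_mul, abs_of_pos (show 0 < 1 + p by positivity)] at hk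
      push Not at hk
      exact lt_of_mul_lt_mul_right (hk.trans_le h2) (by positivity)
    rw [abs_lt] at h4
    rw [Finset.mem_Ico, Nat.ceil_le, Nat.lt_ceil]
    constructor <;> linarith
  have hcard : ((Finset.Ico ⌈μ - √n⌉₊ ⌈μ + √n⌉₊).card : ℝ) ≤ 3 * √n := by
    rw [Nat.card_Ico]
    have h1 := Nat.le_ceil (μ - √n)
    have h2 := Nat.ceil_lt_add_one (show 0 ≤ μ + √n by positivity)
    rw [Nat.cast_sub (Nat.ceil_mono (by linarith))]
    linarith
  have hnear : ∑ k ∈ (Finset.range (n + 1)).filter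
      (fun k : ℕ => ¬ 2 * √(n * p) ≤ |(k : ℝ) * (1 + p) - n * p|),
      binomialWeight p n k ≤ 3 * √n * W := by
    refine (Finset.sum_le_sum_of_subset_of_nonneg hsub fun k _ _ =>
      binomialWeight_nonneg hp n k).trans ?_
    refine (Finset.sum_le_card_nsmul _ _ W fun k _ => binomialWeight_le_mode hp n k).trans ?_
    rw [nsmul_eq_mul]
    gcongr
  rw [← mul_div_assoc, div_le_iff₀ (by positivity)]
  linarith

end binomialWeight

/-! ### The probability that a given edge is minimal -/

lemma pow_add_sub_pow_le {x y : ℝ} (hx : 0 ≤ x) (hy : 0 ≤ y) (m : ℕ) :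
    (x + y) ^ m - x ^ m ≤ m * y * (x + y) ^ (m - 1) := by
  have h := (le_abs_self _).trans (abs_pow_sub_pow_le (x + y) x m)
  rw [abs_of_nonneg hx, abs_of_nonneg (add_nonneg hx hy), add_sub_cancel_left,
    abs_of_nonneg hy, max_eq_left (by linarith)] at h
  linarith

lemma le_pow_add_sub_pow {x y : ℝ} (hx : 0 ≤ x) (hy : 0 ≤ y) (m : ℕ) :
    (m + 1) * y * x ^ m ≤ (x + y) ^ (m + 1) - x ^ (m + 1) := by
  induction m with
  | zero => simp
  | succ m ih =>
    have h1 := mul_le_mul_of_nonneg_left ih hx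
    have h2 : x ^ (m + 1) ≤ (x + y) ^ (m + 1) := by gcongr; linarith
    have h3 := mul_nonneg hy (sub_nonneg.2 h2)
    push_cast
    rw [pow_succ (x + y) (m + 1), pow_succ x (m + 1)]
    rw [pow_succ x m] at *
    nlinarith

/-- The probability that a given `k`-set with `j` vertices outside is a minimal edge is at most
`O(p ^ k)`, and smaller still unless the expected number `m * q ^ j` of edges inside the set is of
order `1`. -/
lemma minimal_probability_le {p q : ℝ} (hp : 0 < p) (hq : 0 < q) (hpq : p + q = 1) {m j k : ℕ}
    (hm : 1 ≤ m) (hk : 1 ≤ k) :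
    (1 - q ^ j + p ^ k * q ^ j) ^ m - (1 - q ^ j) ^ m ≤
      p ^ k * (2 * Real.exp 1 / q ^ 2 * min (m * q ^ j) (m * q ^ j)⁻¹) := by
  have hq1 : q ≤ 1 := by linarith
  have hqj : q ^ j ≤ 1 := pow_le_one₀ hq.le hq1
  have hqj0 : 0 < q ^ j := by positivity
  have hm0 : (0 : ℝ) < m := by exact_mod_cast hm
  have hpk : p ^ k ≤ p := pow_le_of_le_one hp.le (by linarith) (by omega)
  refine (pow_add_sub_pow_le (by linarith) (by positivity) m).trans ?_
  have hbase : 1 - q ^ j + p ^ k * q ^ j ≤ Real.exp (-q ^ (j + 1)) := by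
    refine le_trans ?_ (Real.one_sub_le_exp_neg _)
    rw [pow_succ]
    nlinarith
  have hbase0 : 0 ≤ 1 - q ^ j + p ^ k * q ^ j := by
    have : 0 ≤ p ^ k * q ^ j := by positivity
    linarith
  set t := m * q ^ j with ht
  have ht0 : 0 < t := by positivity
  have hexp : (1 - q ^ j + p ^ k * q ^ j) ^ (m - 1) ≤ Real.exp 1 * Real.exp (-(q * t)) := by
    refine (pow_le_pow_left₀ hbase0 hbase _).trans ?_
    rw [← Real.exp_nat_mul, ← Real.exp_add, Nat.cast_sub hm, Real.exp_le_exp, ht]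
    have : q ^ (j + 1) ≤ 1 := pow_le_one₀ hq.le hq1
    rw [pow_succ] at *
    push_cast
    nlinarith
  have hK : t * (Real.exp 1 * Real.exp (-(q * t))) ≤
      2 * Real.exp 1 / q ^ 2 * min t t⁻¹ := by
    have he : Real.exp (-(q * t)) ≤ 1 := Real.exp_le_one_iff.2 (by
      have : 0 < q * t := by positivity
      linarith)
    rw [mul_min_of_nonneg _ _ (by positivity)]
    refine le_min ?_ ?_
    · have h1 : 1 ≤ 2 / q ^ 2 := by
        rw [le_div_iff₀ (by positivity)]
        nlinarith
      calc t * (Real.exp 1 * Real.exp (-(q * t))) ≤ t * (Real.exp 1 * 1) := by gcongr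
        _ = 1 * (Real.exp 1 * t) := by ring
        _ ≤ 2 / q ^ 2 * (Real.exp 1 * t) := by gcongr
        _ = _ := by ring
    -- for large `t`, use `u ^ 2 * exp (-u) ≤ 2` with `u = q * t`
    · have h1 : (q * t) ^ 2 * Real.exp (-(q * t)) ≤ 2 := by
        rw [Real.exp_neg, ← div_eq_mul_inv, div_le_iff₀ (Real.exp_pos _)]
        have h0 : 0 ≤ q * t := by positivity
        have := Real.quadratic_le_exp_of_nonneg h0
        linarith
      calc t * (Real.exp 1 * Real.exp (-(q * t)))
          = Real.exp 1 / q ^ 2 * ((q * t) ^ 2 * Real.exp (-(q * t))) * t⁻¹ := by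
            field_simp
        _ ≤ Real.exp 1 / q ^ 2 * 2 * t⁻¹ := by gcongr
        _ = _ := by ring
  calc m * (p ^ k * q ^ j) * (1 - q ^ j + p ^ k * q ^ j) ^ (m - 1)
      ≤ m * (p ^ k * q ^ j) * (Real.exp 1 * Real.exp (-(q * t))) := by gcongr
    _ = p ^ k * (t * (Real.exp 1 * Real.exp (-(q * t)))) := by rw [ht]; ring
    _ ≤ _ := by gcongr

/-- If the expected number `m * q ^ j` of edges inside a given `k`-set is of order `1`, the set is a
minimal edge with probability at least of order `p ^ k`. -/
lemma le_minimal_probability {p q : ℝ} (hp : 0 < p) (hq : 0 < q) (hpq : p + q = 1) {m j : ℕ}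
    (hm : 1 ≤ m) (hj : 1 ≤ j) (k : ℕ) :
    p ^ k * (m * q ^ j * Real.exp (-(m * q ^ j / p))) ≤
      (1 - q ^ j + p ^ k * q ^ j) ^ m - (1 - q ^ j) ^ m := by
  have hqj : q ^ j ≤ q := pow_le_of_le_one hq.le (by linarith) (by omega)
  have hqj0 : 0 < q ^ j := by positivity
  have hx0 : 0 < 1 - q ^ j := by linarith
  obtain ⟨l, rfl⟩ := Nat.exists_eq_add_of_le' hm
  refine le_trans ?_ (le_pow_add_sub_pow hx0.le (by positivity) l)
  have hbase : Real.exp (-(q ^ j / p)) ≤ 1 - q ^ j := by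
    rw [← Real.le_log_iff_exp_le hx0]
    refine le_trans ?_ (Real.one_sub_inv_le_log_of_pos hx0)
    have h1 : 1 - (1 - q ^ j)⁻¹ = -(q ^ j / (1 - q ^ j)) := by
      field_simp
      ring
    rw [h1, neg_le_neg_iff]
    gcongr
    linarith
  have hexp : Real.exp (-((l + 1 : ℕ) * q ^ j / p)) ≤ (1 - q ^ j) ^ l := by
    refine le_trans ?_ (pow_le_pow_left₀ (Real.exp_pos _).le hbase l)
    rw [← Real.exp_nat_mul, Real.exp_le_exp]
    have : 0 < q ^ j / p := by positivity
    push_cast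
    rw [mul_div_assoc]
    nlinarith
  calc p ^ k * ((l + 1 : ℕ) * q ^ j * Real.exp (-((l + 1 : ℕ) * q ^ j / p)))
      ≤ p ^ k * ((l + 1 : ℕ) * q ^ j * (1 - q ^ j) ^ l) := by gcongr
    _ = _ := by push_cast; ring

/-- The numbers `min t t⁻¹` along a geometric progression `t = m * q ^ j` decay geometrically in
both directions from the index where `t` crosses `1`. -/
lemma sum_min_inv_geometric_le {q : ℝ} (hq0 : 0 < q) (hq1 : q < 1) {m : ℝ} (hm : 0 < m) (N : ℕ) :
    ∑ j ∈ Finset.range N, min (m * q ^ j) (m * q ^ j)⁻¹ ≤ 2 * (1 - q)⁻¹ := by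
  have hex : ∃ j : ℕ, m * q ^ j ≤ 1 := by
    obtain ⟨j, hj⟩ := exists_pow_lt_of_lt_one (inv_pos.2 hm) hq1
    refine ⟨j, ?_⟩
    calc m * q ^ j ≤ m * m⁻¹ := by gcongr
      _ = 1 := mul_inv_cancel₀ hm.ne'
  classical
  set J := Nat.find hex with hJ
  have hnonneg (j : ℕ) : 0 ≤ min (m * q ^ j) (m * q ^ j)⁻¹ :=
    le_min (by positivity) (by positivity)
  have hgeom (N : ℕ) : ∑ i ∈ Finset.range N, q ^ i ≤ (1 - q)⁻¹ := by
    rw [← tsum_geometric_of_lt_one hq0.le hq1]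
    exact (summable_geometric_of_lt_one hq0.le hq1).sum_le_tsum _ fun i _ => by positivity
  calc ∑ j ∈ Finset.range N, min (m * q ^ j) (m * q ^ j)⁻¹
      ≤ ∑ j ∈ Finset.range (J + N), min (m * q ^ j) (m * q ^ j)⁻¹ :=
        Finset.sum_le_sum_of_subset_of_nonneg (Finset.range_mono (Nat.le_add_left _ _))
          fun j _ _ => hnonneg j
    _ = ∑ j ∈ Finset.range J, min (m * q ^ j) (m * q ^ j)⁻¹ +
        ∑ i ∈ Finset.range N, min (m * q ^ (J + i)) (m * q ^ (J + i))⁻¹ :=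
        Finset.sum_range_add _ _ _
    _ ≤ ∑ j ∈ Finset.range J, q ^ (J - 1 - j) + ∑ i ∈ Finset.range N, q ^ i := by
        gcongr with j hj i hi
        · refine (min_le_right _ _).trans ?_
          have hj := Finset.mem_range.1 hj
          have h1 : 1 < m * q ^ (J - 1) := not_le.1 (Nat.find_min hex (by omega))
          rw [inv_le_iff_one_le_mul₀ (by positivity)]
          calc 1 ≤ m * q ^ (J - 1) := h1.le
            _ = q ^ (J - 1 - j) * (m * q ^ j) := by
              rw [mul_left_comm, ← pow_add]
              congr 2
              omega
        · refine (min_le_left _ _).trans ?_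
          have h1 : m * q ^ J ≤ 1 := Nat.find_spec hex
          rw [pow_add, ← mul_assoc]
          exact mul_le_of_le_one_left (by positivity) h1
    _ ≤ (1 - q)⁻¹ + (1 - q)⁻¹ := by
        rw [Finset.sum_range_reflect (fun i => q ^ i)]
        exact add_le_add (hgeom _) (hgeom _)
    _ = _ := by ring

/-! ### Bounds for the expectation -/

section bounds

variable {p : unitInterval}

lemma expectedMin_le_sum (hp : 0 < p ∧ p < 1) :
    ∃ K > 0, ∀ n m : ℕ, 1 ≤ m → expectedMin n m p ≤
      1 + K * ∑ k ∈ Finset.range (n + 1), binomialWeight p n k *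
        min (m * (1 - p : ℝ) ^ (n - k)) (m * (1 - p : ℝ) ^ (n - k))⁻¹ := by
  have hp0 : (0 : ℝ) < p := hp.1
  have hq0 : 0 < 1 - (p : ℝ) := sub_pos.2 (show (p : ℝ) < 1 from hp.2)
  set q := 1 - (p : ℝ) with hq
  refine ⟨2 * Real.exp 1 / q ^ 2, by positivity, fun n m hm => ?_⟩
  rw [expectedMin_eq_sum, ← hq, Finset.mul_sum,
    show (1 : ℝ) = ∑ k ∈ Finset.range (n + 1), if k = 0 then 1 else 0 by simp,
    ← Finset.sum_add_distrib]
  refine Finset.sum_le_sum fun k _ => ?_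
  rw [show (∑ k ∈ Finset.range (n + 1), if k = 0 then 1 else 0 : ℝ) = 1 by simp]
  have hmin : 0 ≤ min (m * q ^ (n - k)) (m * q ^ (n - k))⁻¹ := by positivity
  rcases Nat.eq_zero_or_pos k with rfl | hk
  · have h1 : 0 ≤ (1 - q ^ n) ^ m := by
      have : q ^ n ≤ 1 := pow_le_one₀ hq0.le (by linarith)
      exact pow_nonneg (by linarith) _
    have h2 := binomialWeight_nonneg hp0 n 0
    have h3 : 0 ≤ 2 * Real.exp 1 / q ^ 2 * (binomialWeight p n 0 *
      min (m * q ^ (n - 0)) (m * q ^ (n - 0))⁻¹) := by positivity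
    simp only [Nat.sub_zero, Nat.choose_zero_right, Nat.cast_one, pow_zero, one_mul,
      sub_add_cancel, one_pow, if_true] at h3 ⊢
    linarith
  · rw [if_neg hk.ne', zero_add]
    have h := minimal_probability_le (j := n - k) hp0 hq0 (by rw [hq]; ring) hm hk
    calc _ ≤ (n.choose k : ℝ) * _ := mul_le_mul_of_nonneg_left h (by positivity)
      _ = _ := by rw [binomialWeight]; ring

/-- Only geometrically few edge sizes contribute, each at most the largest binomial weight. -/
theorem exists_expectedMin_le (hp : 0 < p ∧ p < 1) :
    ∃ C > 0, ∀ n m : ℕ, 1 ≤ n → 1 ≤ m →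
      expectedMin n m p ≤ C * ((1 + (p : ℝ)) ^ n / √n) := by
  have hp0 : (0 : ℝ) < p := hp.1
  have hp1 : (p : ℝ) < 1 := hp.2
  obtain ⟨K, hK, hsum⟩ := expectedMin_le_sum hp
  obtain ⟨C, hC, hw⟩ := exists_binomialWeight_le hp0
  refine ⟨C + K * (C * (2 * (p : ℝ)⁻¹)), by positivity, fun n m hn hm => ?_⟩
  refine (hsum n m hm).trans ?_
  have h1 : 1 ≤ C * ((1 + (p : ℝ)) ^ n / √n) := by
    simpa [binomialWeight] using hw n 0 hn
  have hm0 : (0 : ℝ) < m := by exact_mod_cast hm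
  have hq0 : 0 < 1 - (p : ℝ) := by linarith
  have h2 : ∑ k ∈ Finset.range (n + 1), binomialWeight p n k *
      min (m * (1 - p : ℝ) ^ (n - k)) (m * (1 - p : ℝ) ^ (n - k))⁻¹ ≤
      C * ((1 + (p : ℝ)) ^ n / √n) * (2 * (p : ℝ)⁻¹) := by
    have h3 := sum_min_inv_geometric_le hq0 (by linarith) hm0 (n + 1)
    rw [sub_sub_cancel, ← Finset.sum_range_reflect] at h3
    refine le_trans ?_ (mul_le_mul_of_nonneg_left h3 (by positivity))
    rw [Finset.mul_sum]
    refine Finset.sum_le_sum fun k _ => ?_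
    rw [Nat.add_sub_cancel]
    exact mul_le_mul_of_nonneg_right (hw n k hn) (by positivity)
  calc _ ≤ C * ((1 + (p : ℝ)) ^ n / √n) +
        K * (C * ((1 + (p : ℝ)) ^ n / √n) * (2 * (p : ℝ)⁻¹)) := by gcongr
    _ = _ := by ring

/-- When `m` is close to `(1 - p) ^ (-n / (1 + p))`, the edges whose size is the mode of the
binomial weights alone contribute the right order of magnitude. -/
theorem exists_le_expectedMin (hp : 0 < p ∧ p < 1) :
    ∃ c > 0, ∀ n m : ℕ, 1 ≤ n → 1 ≤ m → |(m : ℝ) - optimalEdges n p| < 1 →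
      c * ((1 + (p : ℝ)) ^ n / √n) ≤ expectedMin n m p := by
  have hp0 : (0 : ℝ) < p := hp.1
  have hp1 : (p : ℝ) < 1 := hp.2
  have hq0 : 0 < 1 - (p : ℝ) := by linarith
  set q := 1 - (p : ℝ) with hq
  have hq1 : q < 1 := by linarith
  refine ⟨1 / 4 * (q / 2 * Real.exp (-(2 / q / p))), by positivity, fun n m hn hm hopt => ?_⟩
  have hn1 : (1 : ℝ) ≤ n := by exact_mod_cast hn
  have hm1 : (1 : ℝ) ≤ m := by exact_mod_cast hm
  set a := (n : ℝ) / (1 + p) with ha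
  have hopt_eq : optimalEdges n p = q ^ (-a) := by
    rw [optimalEdges, Real.rpow_neg hq0.le, one_div]
  rw [hopt_eq, abs_lt] at hopt
  have hopt1 : 1 ≤ q ^ (-a) :=
    Real.one_le_rpow_of_pos_of_le_one_of_nonpos hq0 hq1.le (by
      have : 0 ≤ a := by positivity
      linarith)
  have hm_upper : (m : ℝ) ≤ 2 * q ^ (-a) := by linarith
  have hm_lower : q ^ (-a) ≤ 2 * m := by linarith
  set k := binomialMode p n with hk
  have hk_upper := binomialMode_le hp0 n
  have hk_lower := lt_binomialMode_add_one (p : ℝ) n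
  rw [← hk] at hk_upper hk_lower
  have hsplit : ((n : ℝ) + 1) * p / (1 + p) = n - a + p / (1 + p) := by
    rw [ha]; field_simp; ring
  have hpp0 : 0 ≤ (p : ℝ) / (1 + p) := by positivity
  have hpp1 : (p : ℝ) / (1 + p) ≤ 1 := by
    rw [div_le_one (by positivity)]; linarith
  rw [hsplit] at hk_upper hk_lower
  have hkn : k < n := by
    have : (p : ℝ) / (1 + p) < a := by
      rw [ha]; gcongr; linarith
    exact_mod_cast (show (k : ℝ) < n by linarith)
  have hpow : q ^ (n - k) = q ^ ((n : ℝ) - k) := by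
    rw [← Nat.cast_sub hkn.le, Real.rpow_natCast]
  have ht_eq : q ^ (-a) * q ^ (n - k) = q ^ ((n : ℝ) - k - a) := by
    rw [hpow, ← Real.rpow_add hq0]
    ring_nf
  have ht_lower : q / 2 ≤ m * q ^ (n - k) := by
    have h1 : q ^ (1 : ℝ) ≤ q ^ ((n : ℝ) - k - a) :=
      Real.rpow_le_rpow_of_exponent_ge hq0 hq1.le (by linarith)
    rw [Real.rpow_one, ← ht_eq] at h1
    have h2 := mul_le_mul_of_nonneg_right hm_lower (pow_pos hq0 (n - k)).le
    linarith
  have ht_upper : m * q ^ (n - k) ≤ 2 / q := by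
    have h1 : q ^ ((n : ℝ) - k - a) ≤ q ^ (-1 : ℝ) :=
      Real.rpow_le_rpow_of_exponent_ge hq0 hq1.le (by linarith)
    rw [Real.rpow_neg_one, ← ht_eq] at h1
    have h2 := mul_le_mul_of_nonneg_right hm_upper (pow_pos hq0 (n - k)).le
    rw [div_eq_mul_inv]
    linarith
  have hterm (i : ℕ) : 0 ≤ (n.choose i : ℝ) *
      ((1 - q ^ (n - i) + (p : ℝ) ^ i * q ^ (n - i)) ^ m - (1 - q ^ (n - i)) ^ m) := by
    have h0 : 0 ≤ 1 - q ^ (n - i) := by linarith [pow_le_one₀ (n := n - i) hq0.le hq1.le]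
    refine mul_nonneg (by positivity) (sub_nonneg.2 (pow_le_pow_left₀ h0 ?_ m))
    have : 0 ≤ (p : ℝ) ^ i * q ^ (n - i) := by positivity
    linarith
  rw [expectedMin_eq_sum, ← hq]
  refine le_trans ?_ (Finset.single_le_sum (fun i _ => hterm i)
    (show k ∈ Finset.range (n + 1) from Finset.mem_range.2 (by omega)))
  have hprob := le_minimal_probability (j := n - k) hp0 hq0 (by rw [hq]; ring) hm (by omega) k
  have hexp : q / 2 * Real.exp (-(2 / q / p)) ≤
      m * q ^ (n - k) * Real.exp (-(m * q ^ (n - k) / p)) := by gcongr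
  have hW := le_binomialWeight_mode hp0 hn
  rw [← hk] at hW
  calc 1 / 4 * (q / 2 * Real.exp (-(2 / q / p))) * ((1 + (p : ℝ)) ^ n / √n)
      = 1 / 4 * ((1 + (p : ℝ)) ^ n / √n) * (q / 2 * Real.exp (-(2 / q / p))) := by ring
    _ ≤ binomialWeight p n k * (m * q ^ (n - k) * Real.exp (-(m * q ^ (n - k) / p))) := by
        gcongr
        exact binomialWeight_nonneg hp0 n k
    _ = (n.choose k : ℝ) *
          ((p : ℝ) ^ k * (m * q ^ (n - k) * Real.exp (-(m * q ^ (n - k) / p)))) := by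
        rw [binomialWeight]; ring
    _ ≤ _ := mul_le_mul_of_nonneg_left hprob (by positivity)

/-- When the exponent of `m` is far from `1 / (1 + p)`, each edge size is either far from the mean
of the binomial weights, or far from the sizes at which minimal edges are likely. -/
theorem exists_expectedMin_le_of_exponent_far (hp : 0 < p ∧ p < 1) {ε : ℝ} (hε : 0 < ε) :
    ∃ C > 0, ∀ n m : ℕ, 1 ≤ n → 1 ≤ m → ε ≤ |edgeExponent n m p - 1 / (1 + (p : ℝ))| →
      expectedMin n m p ≤
        1 + C * ((1 + (p : ℝ)) ^ n * (1 / n + ((1 - (p : ℝ)) ^ (ε / 2)) ^ n)) := by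
  have hp0 : (0 : ℝ) < p := hp.1
  have hp1 : (p : ℝ) < 1 := hp.2
  obtain ⟨K, hK, hsum⟩ := expectedMin_le_sum hp
  have hq0 : 0 < 1 - (p : ℝ) := by linarith
  set q := 1 - (p : ℝ) with hq
  have hq1 : q < 1 := by linarith
  set A := 4 * p / (ε * (1 + p)) ^ 2 with hA
  have hA0 : 0 < A := by positivity
  refine ⟨K * (A + 1), by positivity, fun n m hn hm hfar => ?_⟩
  refine (hsum n m hm).trans ?_
  have hn0 : (0 : ℝ) < n := by exact_mod_cast hn
  have hm0 : (0 : ℝ) < m := by exact_mod_cast hm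
  set α := edgeExponent n m p with hα
  have hm_eq : (m : ℝ) = q ^ (-(α * n)) := by
    have : -(α * n) = Real.logb q m := by
      rw [hα, edgeExponent, ← hq]
      field_simp
    rw [this, Real.rpow_logb hq0 hq1.ne hm0]
  set r := q ^ (ε / 2) with hr
  have hr0 : 0 < r := Real.rpow_pos_of_pos hq0 _
  have hrn : r ^ n = q ^ (ε / 2 * n) := by
    rw [hr, Real.rpow_mul hq0.le, Real.rpow_natCast]
  set d := ε * n * (1 + p) / 2 with hd
  have hd0 : 0 < d := by positivity
  have hpoint (k : ℕ) (hk : k ∈ Finset.range (n + 1)) :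
      binomialWeight p n k * min (m * q ^ (n - k)) (m * q ^ (n - k))⁻¹ ≤
        (if d ≤ |(k : ℝ) * (1 + p) - n * p| then binomialWeight p n k else 0) +
          binomialWeight p n k * r ^ n := by
    have hw := binomialWeight_nonneg hp0 n k
    have hkn : k ≤ n := Nat.lt_succ_iff.1 (Finset.mem_range.1 hk)
    have ht : m * q ^ (n - k) = q ^ ((n : ℝ) - k - α * n) := by
      rw [hm_eq, ← Real.rpow_natCast q (n - k), Nat.cast_sub hkn, ← Real.rpow_add hq0]
      ring_nf
    rw [ht, ← Real.rpow_neg hq0.le]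
    split_ifs with hdk
    · have h1 : min (q ^ ((n : ℝ) - k - α * n)) (q ^ (-((n : ℝ) - k - α * n))) ≤ 1 := by
        rcases le_total 0 ((n : ℝ) - k - α * n) with h | h
        · exact (min_le_left _ _).trans (Real.rpow_le_one hq0.le hq1.le h)
        · exact (min_le_right _ _).trans (Real.rpow_le_one hq0.le hq1.le (by linarith))
      have h2 := mul_le_mul_of_nonneg_left h1 hw
      have h3 : 0 ≤ binomialWeight p n k * r ^ n := by positivity
      linarith
    · rw [zero_add]
      refine mul_le_mul_of_nonneg_left ?_ hw
      rw [hrn]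
      have h1 : |(n : ℝ) - k - n / (1 + p)| < ε / 2 * n := by
        have h2 : (k : ℝ) * (1 + p) - n * p = -((n : ℝ) - k - n / (1 + p)) * (1 + p) := by
          field_simp; ring
        rw [h2, abs_mul, abs_neg, abs_of_pos (show (0 : ℝ) < 1 + p by positivity), hd] at hdk
        push Not at hdk
        refine lt_of_mul_lt_mul_right ?_ (show (0 : ℝ) ≤ 1 + p by positivity)
        linarith
      have h3 : ε * n ≤ |α * n - n / (1 + p)| := by
        have h4 : α * n - n / (1 + p) = (α - 1 / (1 + p)) * n := by ring
        rw [h4, abs_mul, abs_of_pos hn0]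
        gcongr
      have h5 : ε / 2 * n ≤ |(n : ℝ) - k - α * n| := by
        have h6 := abs_sub_le (α * n) ((n : ℝ) - k) (n / (1 + p))
        rw [abs_sub_comm (α * n) (n - k)] at h6
        linarith
      rcases le_total 0 ((n : ℝ) - k - α * n) with h | h
      · rw [abs_of_nonneg h] at h5
        exact (min_le_left _ _).trans (Real.rpow_le_rpow_of_exponent_ge hq0 hq1.le h5)
      · rw [abs_of_nonpos h] at h5
        exact (min_le_right _ _).trans (Real.rpow_le_rpow_of_exponent_ge hq0 hq1.le h5)
  have htotal : ∑ k ∈ Finset.range (n + 1), binomialWeight p n k *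
      min (m * q ^ (n - k)) (m * q ^ (n - k))⁻¹ ≤
      (n : ℝ) * p * (1 + (p : ℝ)) ^ n / d ^ 2 + (1 + (p : ℝ)) ^ n * r ^ n := by
    refine (Finset.sum_le_sum hpoint).trans ?_
    rw [Finset.sum_add_distrib, ← Finset.sum_mul, sum_binomialWeight, ← Finset.sum_filter]
    gcongr
    exact sum_filter_binomialWeight_le hp0 n hd0
  have hfirst : (n : ℝ) * p * (1 + (p : ℝ)) ^ n / d ^ 2 = A * ((1 + (p : ℝ)) ^ n * (1 / n)) := by
    rw [hd, hA]
    field_simp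
    ring
  rw [hfirst] at htotal
  have h1 : 0 ≤ (1 + (p : ℝ)) ^ n * (1 / n) := by positivity
  have h2 : 0 ≤ (1 + (p : ℝ)) ^ n * r ^ n := by positivity
  rw [mul_assoc]
  gcongr
  nlinarith

/-! ### Asymptotics -/

lemma isTheta_of_le_of_le {f g : ℕ → ℝ} {c C : ℝ} (hc : 0 < c) (hg : ∀ n, 0 ≤ g n)
    (hlow : ∀ n, 1 ≤ n → c * g n ≤ f n) (hupp : ∀ n, 1 ≤ n → f n ≤ C * g n) :
    f =Θ[atTop] g := by
  constructor
  · refine IsBigO.of_bound C ?_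
    filter_upwards [eventually_ge_atTop 1] with n hn
    rw [Real.norm_of_nonneg (hg n),
      Real.norm_of_nonneg ((mul_nonneg hc.le (hg n)).trans (hlow n hn))]
    exact hupp n hn
  · refine IsBigO.of_bound c⁻¹ ?_
    filter_upwards [eventually_ge_atTop 1] with n hn
    rw [Real.norm_of_nonneg (hg n),
      Real.norm_of_nonneg ((mul_nonneg hc.le (hg n)).trans (hlow n hn)), inv_mul_eq_div,
      le_div_iff₀' hc]
    exact hlow n hn

lemma exists_abs_sub_optimalEdges_lt (hp : 0 < p ∧ p < 1) (n : ℕ) :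
    ∃ m : ℕ, 1 ≤ m ∧ |(m : ℝ) - optimalEdges n p| < 1 := by
  have hq0 : 0 < 1 - (p : ℝ) := sub_pos.2 (show (p : ℝ) < 1 from hp.2)
  have hpos : 0 < optimalEdges n p := one_div_pos.2 (Real.rpow_pos_of_pos hq0 _)
  refine ⟨⌈optimalEdges n p⌉₊, Nat.ceil_pos.2 hpos, ?_⟩
  rw [abs_lt]
  constructor
  · linarith [Nat.le_ceil (optimalEdges n p)]
  · linarith [Nat.ceil_lt_add_one hpos.le]

lemma exists_le_maxExpectedMin (hp : 0 < p ∧ p < 1) :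
    ∃ c > 0, ∀ n : ℕ, 1 ≤ n → c * ((1 + (p : ℝ)) ^ n / √n) ≤ maxExpectedMin n p := by
  obtain ⟨c, hc, hlow⟩ := exists_le_expectedMin hp
  refine ⟨c, hc, fun n hn => ?_⟩
  obtain ⟨m, hm, hopt⟩ := exists_abs_sub_optimalEdges_lt hp n
  exact (hlow n m hn hm hopt).trans (expectedMin_le_maxExpectedMin hm hp)

lemma one_add_pow_div_sqrt_nonneg (p : unitInterval) (n : ℕ) : 0 ≤ (1 + (p : ℝ)) ^ n / √n := by
  have := p.2.1
  positivity

theorem maxExpectedMin_isTheta (hp : 0 < p ∧ p < 1) :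
    (fun n : ℕ => maxExpectedMin n p) =Θ[atTop] (fun n : ℕ => (1 + (p : ℝ)) ^ n / √n) := by
  obtain ⟨c, hc, hlow⟩ := exists_le_maxExpectedMin hp
  obtain ⟨C, -, hupp⟩ := exists_expectedMin_le hp
  refine isTheta_of_le_of_le (C := C) hc (one_add_pow_div_sqrt_nonneg p) hlow fun n hn => ?_
  obtain ⟨m, hm, hmax⟩ := (isGreatest_maxExpectedMin n hp).1
  rw [hmax]
  exact hupp n m hn hm

theorem expectedMin_isTheta (hp : 0 < p ∧ p < 1) {m : ℕ → ℕ}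
    (hm : ∀ n : ℕ, 1 ≤ n → 1 ≤ m n ∧ |(m n : ℝ) - optimalEdges n p| < 1) :
    (fun n : ℕ => expectedMin n (m n) p) =Θ[atTop]
      (fun n : ℕ => (1 + (p : ℝ)) ^ n / √n) := by
  obtain ⟨c, hc, hlow⟩ := exists_le_expectedMin hp
  obtain ⟨C, -, hupp⟩ := exists_expectedMin_le hp
  exact isTheta_of_le_of_le hc (one_add_pow_div_sqrt_nonneg p)
    (fun n hn => hlow n _ hn (hm n hn).1 (hm n hn).2) fun n hn => hupp n _ hn (hm n hn).1

theorem tendsto_edgeExponent (hp : 0 < p ∧ p < 1) {m : ℕ → ℕ}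
    (hm : ∀ n : ℕ, 1 ≤ n → 1 ≤ m n ∧ expectedMin n (m n) p = maxExpectedMin n p) :
    Tendsto (fun n : ℕ => edgeExponent n (m n) p) atTop (𝓝 (1 / (1 + (p : ℝ)))) := by
  have hp0 : (0 : ℝ) < p := hp.1
  have hp1 : (p : ℝ) < 1 := hp.2
  have hq0 : 0 < 1 - (p : ℝ) := by linarith
  obtain ⟨c, hc, hlow⟩ := exists_le_maxExpectedMin hp
  rw [Metric.tendsto_nhds]
  intro ε hε
  obtain ⟨C, hC, hupp⟩ := exists_expectedMin_le_of_exponent_far hp hε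
  set r := (1 - (p : ℝ)) ^ (ε / 2) with hr
  have hr0 : 0 < r := Real.rpow_pos_of_pos hq0 _
  have hr1 : r < 1 := Real.rpow_lt_one hq0.le (by linarith) (by linarith)
  have hs1 : (1 + (p : ℝ))⁻¹ < 1 := inv_lt_one_of_one_lt₀ (by linarith)
  -- the upper bound for exponents at distance at least `ε`, divided by `(1 + p) ^ n / √n`,
  -- tends to zero
  have hlim : Tendsto (fun n : ℕ => (n : ℝ) * (1 + (p : ℝ))⁻¹ ^ n +
      C * (1 / √n + n * r ^ n)) atTop (𝓝 0) := by
    have h1 := tendsto_self_mul_const_pow_of_lt_one (by positivity) hs1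
    have h2 := tendsto_self_mul_const_pow_of_lt_one hr0.le hr1
    have h3 : Tendsto (fun n : ℕ => 1 / √(n : ℝ)) atTop (𝓝 0) := by
      simp_rw [one_div]
      exact (Real.tendsto_sqrt_atTop.comp tendsto_natCast_atTop_atTop).inv_tendsto_atTop
    simpa using h1.add ((h3.add h2).const_mul C)
  filter_upwards [hlim.eventually_lt_const hc, eventually_ge_atTop 1] with n hsmall hn
  rw [Real.dist_eq]
  by_contra hfar
  push Not at hfar
  have h1 := (hlow n hn).trans_eq (hm n hn).2.symm
  have h2 := h1.trans (hupp n (m n) hn (hm n hn).1 hfar)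
  have hn1 : (1 : ℝ) ≤ n := by exact_mod_cast hn
  have hsn : 0 < √(n : ℝ) := by positivity
  have hsle : √(n : ℝ) ≤ n := (Real.sqrt_le_left (by positivity)).2 (by nlinarith)
  have hP : 0 < (1 + (p : ℝ)) ^ n := by positivity
  have h3 : c ≤ √n * (1 + (p : ℝ))⁻¹ ^ n + C * (1 / √n + √n * r ^ n) := by
    refine le_of_mul_le_mul_right (h2.trans_eq ?_) (show 0 < (1 + (p : ℝ)) ^ n / √n by positivity)
    have h4 : 1 / (n : ℝ) = 1 / √n / √n := by
      rw [div_div, Real.mul_self_sqrt (by positivity)]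
    rw [h4, inv_pow]
    field_simp
  refine absurd hsmall (not_lt.2 (h3.trans ?_))
  gcongr

end bounds

theorem theorem2 (p : unitInterval) :
    -- degenerate probabilities: exactly one minimal edge, almost surely, for all `n` and `m`
    ((p = 0 ∨ p = 1) → ∀ n : ℕ, 1 ≤ n →
      (∀ m : ℕ, 1 ≤ m → ∀ᵐ B ∂(hypergraphLaw n m p), (minimization B).ncard = 1) ∧
      IsGreatest (expectedMinValues n p) 1) ∧
    ((0 < p ∧ p < 1) →
      -- the supremum over `m ≥ 1` is a maximum
      (∀ n : ℕ, 1 ≤ n → IsGreatest (expectedMinValues n p) (maxExpectedMin n p)) ∧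
      -- the order of magnitude of the maximum
      (fun n : ℕ => maxExpectedMin n p) =Θ[atTop]
        (fun n : ℕ => (1 + (p : ℝ)) ^ n / Real.sqrt n) ∧
      -- this order is attained when `1 / (1 - p) ^ (n / (1 + p))` is rounded either way
      (∀ m : ℕ → ℕ, (∀ n : ℕ, 1 ≤ n → 1 ≤ m n ∧ |(m n : ℝ) - optimalEdges n p| < 1) →
        (fun n : ℕ => expectedMin n (m n) p) =Θ[atTop]
          (fun n : ℕ => maxExpectedMin n p)) ∧
      -- all exact maximizers have `α → 1 / (1 + p)`
      (∀ m : ℕ → ℕ, (∀ n : ℕ, 1 ≤ n → 1 ≤ m n ∧ expectedMin n (m n) p = maxExpectedMin n p) →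
        Tendsto (fun n : ℕ => edgeExponent n (m n) p) atTop (𝓝 (1 / (1 + (p : ℝ)))))) := by
  refine ⟨fun hp n _ => degenerate_expectedMin hp n, fun hp => ⟨fun n _ =>
    isGreatest_maxExpectedMin n hp, maxExpectedMin_isTheta hp, fun m hm => ?_, fun m hm =>
    tendsto_edgeExponent hp hm⟩⟩
  exact (expectedMin_isTheta hp hm).trans (maxExpectedMin_isTheta hp).symm
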